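/- Let $d\ge 1$, let $G\le O(d)$ be a finite group of linear isometries of $\mathbb{R}^d$, and let $S(\mathbb{R}^d)$ be the Euclidean unit sphere. Equip the orbit space $S(\mathbb{R}^d)/G$ with the quotient metric $$d([x],[y])=\min_{p\in G\cdot x,\ q\in G\cdot y}\|p-q\|.$$ A map $F\colon S(\mathbb{R}^d)/G\to\mathbb{R}^n$ is called \emph{polynomial} if there is a $G$-invariant polynomial map $f\colon\mathbb{R}^d\to\mathbb{R}^n$ such that $F([x])=f(x)$ for all $x\in S(\mathbb{R}^d)$, and \emph{bilipschitz} if there are constants $0<\alpha\le\beta<\infty$ with $$\alpha\, d([x],[y])\le\|F([x])-F([y])\|\le\beta\, d([x],[y])\qquad\text{for all }x,y\in S(\mathbb{R}^d)$$ (so every map on a one-point space is bilipschitz). Then the following are equivalent: (a) $G$ acts freely on $S(\mathbb{R}^d)$, that is, no non-identity element of $G$ fixes a point of $S(\mathbb{R}^d)$. (b) There exists a bilipschitz polynomial map $S(\mathbb{R}^d)/G\to\mathbb{R}^n$ for some $n\in\mathbb{N}$. (c) There exists a bilipschitz polynomial map $S(\mathbb{R}^d)/G\to\mathbb{R}^{2d-1}$.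 -/

import Mathlib

noncomputable section

namespace OrbitMetric

/-- The set `X / G` of orbits of an action of a group `G` on `X`. -/
def OrbitSpace (G X : Type*) [Group G] [MulAction G X] : Type _ :=
  MulAction.orbitRel.Quotient G X

section Quotient

variable {G X : Type*} [Group G] [MulAction G X]

/-- The orbit `[x]` of a point `x`. -/
def OrbitSpace.mk (G : Type*) {X : Type*} [Group G] [MulAction G X] (x : X) : OrbitSpace G X :=
  Quotient.mk (MulAction.orbitRel G X) x

theorem OrbitSpace.mk_surjective (a : OrbitSpace G X) : ∃ x : X, OrbitSpace.mk G x = a :=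
  Quotient.exists_rep a

theorem OrbitSpace.mk_eq_mk {x y : X} :
    OrbitSpace.mk G x = OrbitSpace.mk G y ↔ ∃ g : G, g • y = x := by
  have h := Quotient.eq (r := MulAction.orbitRel G X) (x := x) (y := y)
  rw [MulAction.orbitRel_apply, MulAction.mem_orbit_iff] at h
  exact h

/-- The quotient distance on the orbit space, for a group acting by isometries: the infimum of
`dist p q` over all representatives `p` of `a` and `q` of `b`. -/
def quotDist [PseudoMetricSpace X] (a b : OrbitSpace G X) : ℝ :=
  sInf {r : ℝ | ∃ p q : X, OrbitSpace.mk G p = a ∧ OrbitSpace.mk G q = b ∧ r = dist p q}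

theorem quotDist_le [PseudoMetricSpace X] (p q : X) :
    quotDist (OrbitSpace.mk G p) (OrbitSpace.mk G q) ≤ dist p q := by
  refine csInf_le ⟨0, ?_⟩ ⟨p, q, rfl, rfl, rfl⟩
  rintro r ⟨p, q, -, -, rfl⟩
  exact dist_nonneg

theorem quotDist_attained [Finite G] [PseudoMetricSpace X] [IsIsometricSMul G X] (x y : X) :
    ∃ g : G, quotDist (OrbitSpace.mk G x) (OrbitSpace.mk G y) = dist x (g • y) := by
  have : Nonempty G := ⟨1⟩
  obtain ⟨g, hg⟩ := Finite.exists_min (fun g : G => dist x (g • y))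
  refine ⟨g, le_antisymm ?_ ?_⟩
  · have h := quotDist_le (G := G) x (g • y)
    rwa [show OrbitSpace.mk G (g • y) = OrbitSpace.mk G y from
      OrbitSpace.mk_eq_mk.2 ⟨g, rfl⟩] at h
  · refine le_csInf ⟨_, x, y, rfl, rfl, rfl⟩ ?_
    rintro r ⟨p, q, hp, hq, rfl⟩
    obtain ⟨s, rfl⟩ := OrbitSpace.mk_eq_mk.1 hp
    obtain ⟨t, rfl⟩ := OrbitSpace.mk_eq_mk.1 hq
    have h : dist (s • x) (t • y) = dist x ((s⁻¹ * t) • y) := by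
      rw [← dist_smul s x, smul_smul, mul_inv_cancel_left]
    rw [h]
    exact hg _

/-- For a finite group acting by isometries, the quotient distance is a metric. -/
instance [Finite G] [MetricSpace X] [IsIsometricSMul G X] : MetricSpace (OrbitSpace G X) where
  dist a b := quotDist a b
  dist_self a := by
    obtain ⟨x, rfl⟩ := OrbitSpace.mk_surjective a
    refine le_antisymm ((quotDist_le x x).trans (dist_self x).le) ?_
    obtain ⟨g, hg⟩ := quotDist_attained (G := G) x x
    rw [hg]
    exact dist_nonneg
  dist_comm a b := by
    unfold quotDist
    congr 1
    ext r
    constructor <;> rintro ⟨p, q, hp, hq, rfl⟩ <;> exact ⟨q, p, hq, hp, dist_comm _ _⟩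
  dist_triangle a b c := by
    obtain ⟨x, rfl⟩ := OrbitSpace.mk_surjective a
    obtain ⟨y, rfl⟩ := OrbitSpace.mk_surjective b
    obtain ⟨z, rfl⟩ := OrbitSpace.mk_surjective c
    obtain ⟨g, hg⟩ := quotDist_attained (G := G) x y
    obtain ⟨h, hh⟩ := quotDist_attained (G := G) y z
    rw [hg, hh, ← dist_smul g y]
    have h1 : OrbitSpace.mk G (g • h • z) = OrbitSpace.mk G z :=
      OrbitSpace.mk_eq_mk.2 ⟨g * h, mul_smul g h z⟩
    rw [← h1]
    exact (quotDist_le _ _).trans (dist_triangle _ _ _)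
  eq_of_dist_eq_zero {a b} hab := by
    obtain ⟨x, rfl⟩ := OrbitSpace.mk_surjective a
    obtain ⟨y, rfl⟩ := OrbitSpace.mk_surjective b
    obtain ⟨g, hg⟩ := quotDist_attained (G := G) x y
    change quotDist _ _ = 0 at hab
    rw [hg] at hab
    exact OrbitSpace.mk_eq_mk.2 ⟨g, (dist_eq_zero.1 hab).symm⟩

end Quotient

/-- A map of metric spaces is bilipschitz if it has a positive lower Lipschitz bound `α` and a
finite upper Lipschitz bound `β`. -/
def IsBilipschitz {X Y : Type*} [PseudoMetricSpace X] [PseudoMetricSpace Y] (f : X → Y) : Prop :=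
  ∃ α β : ℝ, 0 < α ∧ ∀ x x' : X,
    α * dist x x' ≤ dist (f x) (f x') ∧ dist (f x) (f x') ≤ β * dist x x'

/-- The orthogonal group `O(d)`: linear isometric bijections of Euclidean space. -/
abbrev O (d : ℕ) : Type := EuclideanSpace ℝ (Fin d) ≃ₗᵢ[ℝ] EuclideanSpace ℝ (Fin d)

/-- The unit sphere `S(ℝ^d)`, with the Euclidean distance of `ℝ^d`. -/
abbrev S (d : ℕ) : Type := Metric.sphere (0 : EuclideanSpace ℝ (Fin d)) 1

section Sphere

variable {d : ℕ} (G : Subgroup (O d))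

/-- A subgroup of `O(d)` acts on the unit sphere by `(g, u) ↦ g u`. -/
instance : MulAction G (S d) where
  smul g u := ⟨(g : O d) u, by
    rw [mem_sphere_zero_iff_norm, LinearIsometryEquiv.norm_map, norm_eq_of_mem_sphere]⟩
  one_smul _ := rfl
  mul_smul _ _ _ := rfl

theorem coe_smul (g : G) (u : S d) :
    ((g • u : S d) : EuclideanSpace ℝ (Fin d)) = (g : O d) (u : EuclideanSpace ℝ (Fin d)) := rfl

instance : IsIsometricSMul G (S d) where
  isometry_smul g := Isometry.of_dist_eq fun u v => by
    rw [Subtype.dist_eq, Subtype.dist_eq, coe_smul, coe_smul, LinearIsometryEquiv.dist_map]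

/-- The group acts freely on the unit sphere: only the identity fixes a point. -/
def ActsFreelyOnSphere : Prop :=
  ∀ (g : G) (u : S d), g • u = u → g = 1

/-- The polynomial map `ℝ^d → ℝ^n` with coordinate polynomials `P 0, …, P (n - 1)`. -/
def polyMap {d n : ℕ} (P : Fin n → MvPolynomial (Fin d) ℝ) (x : EuclideanSpace ℝ (Fin d)) :
    EuclideanSpace ℝ (Fin n) :=
  WithLp.toLp 2 fun i => MvPolynomial.eval (fun j => x j) (P i)

/-- `F : S(ℝ^d)/G → ℝ^n` is a polynomial map: it is induced on orbits by a `G`-invariant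
polynomial map `ℝ^d → ℝ^n`. -/
def IsPolynomialMap {n : ℕ} (F : OrbitSpace G (S d) → EuclideanSpace ℝ (Fin n)) : Prop :=
  ∃ P : Fin n → MvPolynomial (Fin d) ℝ,
    (∀ (g : G) (x : EuclideanSpace ℝ (Fin d)), polyMap P ((g : O d) x) = polyMap P x) ∧
    ∀ u : S d, F (OrbitSpace.mk G u) = polyMap P u

end Sphere

end OrbitMetric

end

/-!
The equivalence reduces to invariant polynomial maps `f : ℝ^d → ℝ^n` with a lower Lipschitz bound
for the quotient distance, because the upper bound is automatic (`exists_isBilipschitz_iff`). For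
such an `f` the lower bound has an infinitesimal description: it holds if and only if `f` separates
orbits and, at each point `x` of the sphere, the differential of `f` is injective on the tangent
space `x^⊥`. Sufficiency is a compactness argument (`IsInvariant.hasLowerBoundOn_univ`); necessity
of the condition on differentials comes from following a great circle
(`HasLowerBoundOn.fderiv_ne_zero`).

If `g` fixes a point `u` of the sphere, invariance makes the differential at `u` kill the tangent
vectors `v - g v`, so a lower bound forces `g = 1` (`HasLowerBoundOn.actsFreelyOnSphere`).

If the action is free, the product of the squared distances to the points of an orbit separates that
orbit from all others (`exists_isInvariant_polyMap_ne`). At a given point `x`, take a polynomial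
map whose differential at `x` is a nonzero multiple of the identity and which vanishes to second
order at the other points of the orbit; summing its translates over `G` gives an invariant map with
the same differential at `x` (`ActsFreelyOnSphere.exists_isInvariant_fderiv_injective`). Finitely
many of these invariants suffice by compactness (`ActsFreelyOnSphere.exists_hasLowerBoundOn`).

The dimension of the target is lowered to `2 d - 1` as in Whitney's embedding theorem. The sphere
has dimension `d - 1`, so multiples of secants of its image, and values of differentials at its
points, form a set of Hausdorff dimension at most `2 d - 1`
(`exists_notMem_secants_notMem_tangents`). In a larger target some direction avoids this set, and
projecting along it preserves the infinitesimal criterion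
(`IsInvariant.exists_hasLowerBoundOn_of_succ`).
-/

noncomputable section

namespace OrbitMetric

open Filter Topology MvPolynomial

/-! ### Invariant polynomial maps and the lower Lipschitz bound -/

section Basic

variable {d n m : ℕ} (G : Subgroup (O d))

/-- Invariance of a polynomial map under `G`. -/
def IsInvariant (P : Fin n → MvPolynomial (Fin d) ℝ) : Prop :=
  ∀ (g : G) (x : EuclideanSpace ℝ (Fin d)), polyMap P ((g : O d) x) = polyMap P x

/-- On the set `s` of pairs of points of the sphere, the polynomial map satisfies the lower
Lipschitz bound with respect to the distance of orbits, with some positive constant. -/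
def HasLowerBoundOn [Finite G] (P : Fin n → MvPolynomial (Fin d) ℝ) (s : Set (S d × S d)) : Prop :=
  ∃ α : ℝ, 0 < α ∧ ∀ p ∈ s,
    α * dist (OrbitSpace.mk G p.1) (OrbitSpace.mk G p.2) ≤ dist (polyMap P p.1) (polyMap P p.2)

theorem contDiff_polyMap (P : Fin n → MvPolynomial (Fin d) ℝ) {k : WithTop ℕ∞} :
    ContDiff ℝ k (polyMap P) := by
  rw [contDiff_euclidean]
  intro i
  change ContDiff ℝ k fun x : EuclideanSpace ℝ (Fin d) => eval (fun j => x j) (P i)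
  induction P i using MvPolynomial.induction_on with
  | C a => simpa using contDiff_const
  | add p q hp hq => simpa using hp.add hq
  | mul_X p j hp =>
    have hj : ContDiff ℝ k fun x : EuclideanSpace ℝ (Fin d) => x j :=
      (EuclideanSpace.proj (𝕜 := ℝ) j).contDiff
    simpa using hp.mul hj

theorem continuous_polyMap (P : Fin n → MvPolynomial (Fin d) ℝ) : Continuous (polyMap P) :=
  (contDiff_polyMap P (k := 0)).continuous

theorem hasStrictFDerivAt_polyMap (P : Fin n → MvPolynomial (Fin d) ℝ)
    (x : EuclideanSpace ℝ (Fin d)) :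
    HasStrictFDerivAt (polyMap P) (fderiv ℝ (polyMap P) x) x :=
  (contDiff_polyMap P (k := 1)).contDiffAt.hasStrictFDerivAt one_ne_zero

variable {G}

theorem dist_mk_le [Finite G] (x y : S d) :
    dist (OrbitSpace.mk G x) (OrbitSpace.mk G y) ≤ dist x y :=
  quotDist_le x y

theorem exists_dist_mk_eq [Finite G] (x y : S d) :
    ∃ g : G, dist (OrbitSpace.mk G x) (OrbitSpace.mk G y) = dist x (g • y) :=
  quotDist_attained x y

theorem mk_smul (g : G) (x : S d) : OrbitSpace.mk G (g • x) = OrbitSpace.mk G x :=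
  OrbitSpace.mk_eq_mk.2 ⟨g, rfl⟩

theorem IsInvariant.polyMap_smul {P : Fin n → MvPolynomial (Fin d) ℝ} (hP : IsInvariant G P)
    (g : G) (x : S d) : polyMap P (g • x : S d) = polyMap P x :=
  hP g x

/-- A polynomial map is Lipschitz on the unit ball, and an invariant one may be evaluated at the
closest representatives. -/
theorem IsInvariant.exists_upper_bound [Finite G] {P : Fin n → MvPolynomial (Fin d) ℝ}
    (hP : IsInvariant G P) : ∃ β : ℝ, ∀ x y : S d,
      dist (polyMap P x) (polyMap P y) ≤ β * dist (OrbitSpace.mk G x) (OrbitSpace.mk G y) := by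
  obtain ⟨K, hK⟩ := ((contDiff_polyMap P (k := 1)).locallyLipschitz.locallyLipschitzOn
    (s := Metric.sphere 0 1)).exists_lipschitzOnWith_of_compact (isCompact_sphere _ _)
  refine ⟨K, fun x y => ?_⟩
  obtain ⟨g, hg⟩ := exists_dist_mk_eq (G := G) x y
  rw [hg, ← hP.polyMap_smul g y]
  exact hK.dist_le_mul _ x.2 _ (g • y).2

/-- A bilipschitz polynomial map on the orbit space amounts to an invariant polynomial map with a
lower Lipschitz bound: the upper bound is automatic. -/
theorem exists_isBilipschitz_iff [Finite G] :
    (∃ F : OrbitSpace G (S d) → EuclideanSpace ℝ (Fin n), IsPolynomialMap G F ∧ IsBilipschitz F) ↔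
      ∃ P : Fin n → MvPolynomial (Fin d) ℝ, IsInvariant G P ∧ HasLowerBoundOn G P Set.univ := by
  constructor
  · rintro ⟨F, ⟨P, hP, hF⟩, α, β, hα, h⟩
    refine ⟨P, hP, α, hα, fun p _ => ?_⟩
    rw [← hF, ← hF]
    exact (h _ _).1
  · rintro ⟨P, hP, α, hα, h⟩
    obtain ⟨β, hβ⟩ := hP.exists_upper_bound
    refine ⟨Quotient.lift (fun x : S d => polyMap P x) ?_, ⟨P, hP, fun u => rfl⟩, α, β, hα, ?_⟩
    · intro x y hxy
      obtain ⟨g, hg⟩ := OrbitSpace.mk_eq_mk.1 (Quotient.sound hxy : OrbitSpace.mk G x = .mk G y)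
      exact (congrArg (fun z : S d => polyMap P z) hg).symm.trans (hP.polyMap_smul g y)
    · intro a b
      obtain ⟨x, rfl⟩ := OrbitSpace.mk_surjective a
      obtain ⟨y, rfl⟩ := OrbitSpace.mk_surjective b
      exact ⟨h (x, y) trivial, hβ x y⟩

end Basic

/-! ### A lower bound forces injective differentials -/

section Necessity

variable {d n : ℕ} {G : Subgroup (O d)} [Finite G]

/-- Close to a given point of an orbit, the quotient distance to that orbit is the distance to the
point itself. -/
theorem eventually_dist_mk_eq (u : S d) :
    ∀ᶠ x : S d in 𝓝 u, dist (OrbitSpace.mk G x) (OrbitSpace.mk G u) = dist x u := by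
  have key : ∀ g : G, ∀ᶠ x : S d in 𝓝 u, dist x u ≤ dist x (g • u) := by
    intro g
    by_cases hg : g • u = u
    · simp [hg]
    · have h0 : dist u u < dist u (g • u) := by
        rw [dist_self]
        exact dist_pos.2 (Ne.symm hg)
      have hc : Continuous fun x : S d => dist x u := by fun_prop
      have hc' : Continuous fun x : S d => dist x (g • u) := by fun_prop
      exact (hc.continuousAt.eventually_lt hc'.continuousAt h0).mono fun x hx => hx.le
  filter_upwards [eventually_all.2 key] with x hx
  obtain ⟨g, hg⟩ := exists_dist_mk_eq (G := G) x u
  exact le_antisymm (dist_mk_le x u) (hg ▸ hx g)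

/-- Along the great circle through `u` in a direction `w` killed by the differential, the values of
the map would approach each other faster than the orbits do. -/
theorem HasLowerBoundOn.fderiv_ne_zero {P : Fin n → MvPolynomial (Fin d) ℝ}
    (h : HasLowerBoundOn G P Set.univ) (u : S d) {w : EuclideanSpace ℝ (Fin d)}
    (huw : inner ℝ (u : EuclideanSpace ℝ (Fin d)) w = 0)
    (hw : fderiv ℝ (polyMap P) u w = 0) : w = 0 := by
  by_contra hw0
  wlog hw1 : ‖w‖ = 1 generalizing w
  · refine this (w := ‖w‖⁻¹ • w) ?_ ?_ ?_ ?_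
    · rw [inner_smul_right, huw, mul_zero]
    · rw [map_smul, hw, smul_zero]
    · simpa using hw0
    · rw [norm_smul, norm_inv, norm_norm, inv_mul_cancel₀ (norm_ne_zero_iff.2 hw0)]
  obtain ⟨α, hα, h⟩ := h
  have hu1 : ‖(u : EuclideanSpace ℝ (Fin d))‖ = 1 := norm_eq_of_mem_sphere u
  have hmem : ∀ t : ℝ, Real.cos t • (u : EuclideanSpace ℝ (Fin d)) + Real.sin t • w ∈
      Metric.sphere (0 : EuclideanSpace ℝ (Fin d)) 1 := by
    intro t
    have h2 : ‖Real.cos t • (u : EuclideanSpace ℝ (Fin d)) + Real.sin t • w‖ ^ 2 = 1 := by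
      rw [norm_add_sq_real, inner_smul_left, inner_smul_right, huw, norm_smul, norm_smul, hu1, hw1]
      simp
    rw [mem_sphere_zero_iff_norm]
    exact (pow_eq_one_iff_of_nonneg (norm_nonneg _) two_ne_zero).1 h2
  let c : ℝ → S d := fun t => ⟨_, hmem t⟩
  have hc0 : c 0 = u := Subtype.ext (by simp [c])
  have hc' : HasDerivAt (fun t => (c t : EuclideanSpace ℝ (Fin d))) w 0 := by
    have h1 := ((Real.hasDerivAt_cos 0).smul_const (u : EuclideanSpace ℝ (Fin d))).add
      ((Real.hasDerivAt_sin 0).smul_const w)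
    have h2 : -Real.sin 0 • (u : EuclideanSpace ℝ (Fin d)) + Real.cos 0 • w = w := by simp
    rw [h2] at h1
    exact h1
  have hcc : Continuous c := Continuous.subtype_mk (by fun_prop) _
  have hf : HasDerivAt (fun t => polyMap P (c t)) 0 0 := by
    have h1 : HasFDerivAt (polyMap P) (fderiv ℝ (polyMap P) u)
        (c 0 : EuclideanSpace ℝ (Fin d)) := by
      rw [hc0]
      exact (hasStrictFDerivAt_polyMap P u).hasFDerivAt
    have h2 := h1.comp_hasDerivAt (0 : ℝ) hc'
    rwa [hw] at h2
  have hev : ∀ᶠ t in 𝓝 (0 : ℝ), dist (OrbitSpace.mk G (c t)) (OrbitSpace.mk G u) = dist (c t) u :=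
    hcc.continuousAt.eventually (by rw [hc0]; exact eventually_dist_mk_eq (G := G) u)
  have hl1 := hc'.tendsto_slope_zero.norm.const_mul α
  have hl2 := hf.tendsto_slope_zero.norm
  have hle := le_of_tendsto_of_tendsto hl1 hl2 (by
    filter_upwards [hev.filter_mono nhdsWithin_le_nhds] with t ht
    have h3 := h (c t, u) trivial
    rw [ht, Subtype.dist_eq, dist_eq_norm, dist_eq_norm] at h3
    rw [zero_add, norm_smul, norm_smul, hc0, mul_left_comm]
    exact mul_le_mul_of_nonneg_left h3 (norm_nonneg _))
  rw [hw1, norm_zero] at hle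
  linarith

/-- If `g` fixes `u`, then the differential at `u` of an invariant map takes the same value at `v`
and at `g v`, so it kills the tangent vector `v - g v`. -/
theorem HasLowerBoundOn.actsFreelyOnSphere {P : Fin n → MvPolynomial (Fin d) ℝ}
    (hP : IsInvariant G P) (h : HasLowerBoundOn G P Set.univ) : ActsFreelyOnSphere G := by
  intro g u hgu
  have hgu' : (g : O d) (u : EuclideanSpace ℝ (Fin d)) = u := congrArg Subtype.val hgu
  ext1
  ext1 v
  change (g : O d) v = v
  have h1 : HasFDerivAt (polyMap P) (fderiv ℝ (polyMap P) u)
      ((g : O d) (u : EuclideanSpace ℝ (Fin d))) := by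
    rw [hgu']
    exact (hasStrictFDerivAt_polyMap P u).hasFDerivAt
  have h2 := h1.comp (u : EuclideanSpace ℝ (Fin d)) (g : O d).toContinuousLinearEquiv.hasFDerivAt
  have h4 := congrArg (fun A => A v)
    ((h2.congr_of_eventuallyEq (f₁ := polyMap P) (by
      filter_upwards with x using (hP g x).symm)).unique
        (hasStrictFDerivAt_polyMap P u).hasFDerivAt)
  refine sub_eq_zero.1 (h.fderiv_ne_zero u (w := (g : O d) v - v) ?_ ?_)
  · rw [inner_sub_right, sub_eq_zero]
    conv_lhs => rw [← hgu']
    exact (g : O d).inner_map_map _ _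
  · rw [map_sub, sub_eq_zero]
    exact h4

end Necessity

/-! ### Local lower bounds -/

section Local

variable {d n : ℕ} {G : Subgroup (O d)} [Finite G]

theorem exists_hasLowerBoundOn_of_ne {P : Fin n → MvPolynomial (Fin d) ℝ} {x y : S d}
    (hxy : polyMap P x ≠ polyMap P y) : ∃ s ∈ 𝓝 (x, y), HasLowerBoundOn G P s := by
  have hc : Continuous fun p : S d × S d => dist (polyMap P p.1) (polyMap P p.2) := by
    have := continuous_polyMap P
    fun_prop
  have hpos : 0 < dist (polyMap P x) (polyMap P y) := dist_pos.2 hxy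
  refine ⟨_, hc.continuousAt.eventually (lt_mem_nhds (half_lt_self hpos)),
    dist (polyMap P x) (polyMap P y) / 4, by positivity, fun p hp => ?_⟩
  have h2 : dist p.1 p.2 ≤ 2 := by
    rw [Subtype.dist_eq, dist_eq_norm]
    refine (norm_sub_le _ _).trans ?_
    rw [norm_eq_of_mem_sphere, norm_eq_of_mem_sphere]
    norm_num
  have h3 := (dist_mk_le (G := G) p.1 p.2).trans h2
  have h4 : dist (polyMap P x) (polyMap P y) / 2 < dist (polyMap P p.1) (polyMap P p.2) := hp
  nlinarith

/-- A map whose strict derivative at `a` is injective satisfies a lower Lipschitz bound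
near `a`. -/
theorem exists_lower_bound_of_hasStrictFDerivAt {E F : Type*} [NormedAddCommGroup E]
    [NormedSpace ℝ E] [FiniteDimensional ℝ E] [NormedAddCommGroup F] [NormedSpace ℝ F]
    {f : E → F} {A : E →L[ℝ] F} {a : E} (hf : HasStrictFDerivAt f A a)
    (hA : Function.Injective A) :
    ∃ c : ℝ, 0 < c ∧ ∀ᶠ p in 𝓝 (a, a), c * ‖p.1 - p.2‖ ≤ ‖f p.1 - f p.2‖ := by
  obtain ⟨K, hK0, hK⟩ := LinearMap.exists_antilipschitzWith (A : E →ₗ[ℝ] F)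
    (LinearMap.ker_eq_bot.2 hA)
  have hK0' : (0 : ℝ) < K := hK0
  refine ⟨(K : ℝ)⁻¹ / 2, by positivity, ?_⟩
  filter_upwards [hf.isLittleO.def (show (0 : ℝ) < (K : ℝ)⁻¹ / 2 by positivity)] with p hp
  have h1 : (K : ℝ)⁻¹ * ‖p.1 - p.2‖ ≤ ‖A (p.1 - p.2)‖ := by
    rw [inv_mul_le_iff₀ hK0']
    simpa [dist_eq_norm] using hK.le_mul_dist (p.1 - p.2) 0
  have h2 : ‖A (p.1 - p.2)‖ ≤ ‖f p.1 - f p.2‖ + ‖f p.1 - f p.2 - A (p.1 - p.2)‖ := by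
    have := norm_sub_le (f p.1 - f p.2) (f p.1 - f p.2 - A (p.1 - p.2))
    rwa [sub_sub_cancel] at this
  linarith

/-- If the differential at `x` is injective on the tangent space of the sphere, a lower bound holds
near every pair `(x, g x)`. -/
theorem IsInvariant.exists_hasLowerBoundOn {P : Fin n → MvPolynomial (Fin d) ℝ}
    (hP : IsInvariant G P) {x : S d}
    (hx : ∀ w : EuclideanSpace ℝ (Fin d), inner ℝ (x : EuclideanSpace ℝ (Fin d)) w = 0 →
      fderiv ℝ (polyMap P) x w = 0 → w = 0) (g : G) :
    ∃ s ∈ 𝓝 (x, g • x), HasLowerBoundOn G P s := by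
  -- Adjoining `‖z‖ ^ 2` makes the derivative injective in all directions, and it does not change
  -- differences of values on the sphere.
  have hF := (hasStrictFDerivAt_polyMap P x).prodMk
    (hasStrictFDerivAt_norm_sq (x : EuclideanSpace ℝ (Fin d)))
  obtain ⟨c, hc, h⟩ := exists_lower_bound_of_hasStrictFDerivAt hF (by
    rw [injective_iff_map_eq_zero]
    intro w hw
    have h1 := congrArg Prod.fst hw
    have h2 := congrArg Prod.snd hw
    refine hx w ?_ h1
    simpa using h2)
  have hcont : Continuous fun p : S d × S d =>
      ((p.1 : EuclideanSpace ℝ (Fin d)), ((g⁻¹ • p.2 : S d) : EuclideanSpace ℝ (Fin d))) := by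
    have : Continuous fun y : S d => g⁻¹ • y := continuous_const_smul g⁻¹
    fun_prop
  have hev := (hcont.tendsto (x, g • x)).eventually
    (p := fun p => c * ‖p.1 - p.2‖ ≤ ‖(polyMap P p.1, ‖p.1‖ ^ 2) - (polyMap P p.2, ‖p.2‖ ^ 2)‖)
    (by simpa only [inv_smul_smul] using h)
  refine ⟨_, hev, c, hc, fun p hp => ?_⟩
  have hp' : c * dist p.1 (g⁻¹ • p.2) ≤ dist (polyMap P p.1) (polyMap P (g⁻¹ • p.2 : S d)) := by
    rw [Subtype.dist_eq, dist_eq_norm, dist_eq_norm]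
    have h5 := Set.mem_ofPred_eq ▸ hp
    simpa [norm_eq_of_mem_sphere, Prod.norm_def] using h5
  rw [hP.polyMap_smul] at hp'
  refine le_trans (mul_le_mul_of_nonneg_left ?_ hc.le) hp'
  rw [← mk_smul g⁻¹ p.2]
  exact dist_mk_le _ _

theorem HasLowerBoundOn.mono {P : Fin n → MvPolynomial (Fin d) ℝ} {s t : Set (S d × S d)}
    (h : HasLowerBoundOn G P t) (hst : s ⊆ t) : HasLowerBoundOn G P s := by
  obtain ⟨α, hα, h⟩ := h
  exact ⟨α, hα, fun p hp => h p (hst hp)⟩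

theorem HasLowerBoundOn.union {P : Fin n → MvPolynomial (Fin d) ℝ} {s t : Set (S d × S d)}
    (hs : HasLowerBoundOn G P s) (ht : HasLowerBoundOn G P t) : HasLowerBoundOn G P (s ∪ t) := by
  obtain ⟨α, hα, hs⟩ := hs
  obtain ⟨β, hβ, ht⟩ := ht
  refine ⟨min α β, lt_min hα hβ, ?_⟩
  rintro p (hp | hp)
  · exact (mul_le_mul_of_nonneg_right (min_le_left _ _) dist_nonneg).trans (hs p hp)
  · exact (mul_le_mul_of_nonneg_right (min_le_right _ _) dist_nonneg).trans (ht p hp)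

/-- An invariant polynomial map that separates orbits and whose differentials are injective on
tangent spaces satisfies a lower Lipschitz bound. -/
theorem IsInvariant.hasLowerBoundOn_univ {P : Fin n → MvPolynomial (Fin d) ℝ}
    (hP : IsInvariant G P)
    (hsep : ∀ x y : S d, polyMap P x = polyMap P y → OrbitSpace.mk G x = OrbitSpace.mk G y)
    (himm : ∀ (x : S d) (w : EuclideanSpace ℝ (Fin d)),
      inner ℝ (x : EuclideanSpace ℝ (Fin d)) w = 0 → fderiv ℝ (polyMap P) x w = 0 → w = 0) :
    HasLowerBoundOn G P Set.univ := by
  refine isCompact_univ.induction_on (p := HasLowerBoundOn G P) ⟨1, one_pos, by simp⟩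
    (fun _ _ hst h => h.mono hst) (fun _ _ hs ht => hs.union ht) ?_
  rintro ⟨x, y⟩ -
  rw [nhdsWithin_univ]
  by_cases hxy : polyMap P x = polyMap P y
  · obtain ⟨g, rfl⟩ := OrbitSpace.mk_eq_mk.1 (hsep x y hxy).symm
    exact hP.exists_hasLowerBoundOn (himm x) g
  · exact exists_hasLowerBoundOn_of_ne hxy

end Local

/-! ### Lowering the dimension of the target -/

section Projection

variable {d n m : ℕ} {G : Subgroup (O d)}

/-- The coordinate polynomials of the composition of a linear map with a polynomial map. -/
def linComp (L : EuclideanSpace ℝ (Fin n) →L[ℝ] EuclideanSpace ℝ (Fin m))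
    (P : Fin n → MvPolynomial (Fin d) ℝ) : Fin m → MvPolynomial (Fin d) ℝ :=
  fun i => ∑ j, C (L (EuclideanSpace.single j 1) i) * P j

theorem polyMap_linComp (L : EuclideanSpace ℝ (Fin n) →L[ℝ] EuclideanSpace ℝ (Fin m))
    (P : Fin n → MvPolynomial (Fin d) ℝ) (x : EuclideanSpace ℝ (Fin d)) :
    polyMap (linComp L P) x = L (polyMap P x) := by
  have h : polyMap P x = ∑ j, polyMap P x j • EuclideanSpace.single j (1 : ℝ) := by
    simpa using ((EuclideanSpace.basisFun (Fin n) ℝ).sum_repr (polyMap P x)).symm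
  rw [h, map_sum]
  ext i
  simp [polyMap, linComp, mul_comm]

theorem IsInvariant.linComp {P : Fin n → MvPolynomial (Fin d) ℝ} (hP : IsInvariant G P)
    (L : EuclideanSpace ℝ (Fin n) →L[ℝ] EuclideanSpace ℝ (Fin m)) :
    IsInvariant G (linComp L P) := fun g x => by
  rw [polyMap_linComp, polyMap_linComp, hP g x]

theorem fderiv_polyMap_linComp (L : EuclideanSpace ℝ (Fin n) →L[ℝ] EuclideanSpace ℝ (Fin m))
    (P : Fin n → MvPolynomial (Fin d) ℝ) (x w : EuclideanSpace ℝ (Fin d)) :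
    fderiv ℝ (polyMap (linComp L P)) x w = L (fderiv ℝ (polyMap P) x w) := by
  have h : polyMap (linComp L P) = L ∘ polyMap P := funext (polyMap_linComp L P)
  rw [h, (L.hasFDerivAt.comp x (hasStrictFDerivAt_polyMap P x).hasFDerivAt).fderiv]
  rfl

theorem exists_continuousLinearMap_ker_le_span {v : EuclideanSpace ℝ (Fin (n + 1))} (hv : v ≠ 0) :
    ∃ L : EuclideanSpace ℝ (Fin (n + 1)) →L[ℝ] EuclideanSpace ℝ (Fin n),
      ∀ z, L z = 0 → ∃ s : ℝ, s • v = z := by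
  have : Fact (Module.finrank ℝ (EuclideanSpace ℝ (Fin (n + 1))) = n + 1) := ⟨by simp⟩
  let e := (OrthonormalBasis.fromOrthogonalSpanSingleton (𝕜 := ℝ) n hv).repr
  refine ⟨e.toContinuousLinearEquiv.toContinuousLinearMap.comp
    (ℝ ∙ v)ᗮ.orthogonalProjectionOnto, fun z hz => ?_⟩
  have h1 : (ℝ ∙ v)ᗮ.orthogonalProjectionOnto z = 0 := e.map_eq_zero_iff.1 hz
  rw [Submodule.orthogonalProjectionOnto_eq_zero_iff, Submodule.orthogonal_orthogonal] at h1
  exact Submodule.mem_span_singleton.1 h1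

/-- Stereographic projection: up to one point, the unit sphere is the image of a smooth map from a
space of dimension `d - 1`. -/
theorem exists_contDiff_parametrization (hd : 1 ≤ d) :
    ∃ (u : EuclideanSpace ℝ (Fin d)) (K : Submodule ℝ (EuclideanSpace ℝ (Fin d)))
      (φ : K → EuclideanSpace ℝ (Fin d)), Module.finrank ℝ K = d - 1 ∧ ContDiff ℝ 1 φ ∧
        ∀ x : S d, (x : EuclideanSpace ℝ (Fin d)) = u ∨ ∃ a, φ a = x := by
  let u : EuclideanSpace ℝ (Fin d) := EuclideanSpace.single ⟨0, hd⟩ 1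
  have hu : ‖u‖ = 1 := by simp [u]
  refine ⟨u, (ℝ ∙ u)ᗮ, fun a => stereoInvFunAux u a, ?_, ?_, fun x => ?_⟩
  · have h1 := (ℝ ∙ u).finrank_add_finrank_orthogonal
    rw [finrank_span_singleton (norm_ne_zero_iff.1 (by rw [hu]; exact one_ne_zero)),
      finrank_euclideanSpace_fin] at h1
    omega
  · exact contDiff_stereoInvFunAux.comp (ℝ ∙ u)ᗮ.subtypeL.contDiff
  · by_cases hx : (x : EuclideanSpace ℝ (Fin d)) = u
    · exact Or.inl hx
    · exact Or.inr ⟨stereoToFun u x, congrArg Subtype.val (stereo_left_inv hu hx)⟩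

/-- The dimension count behind Whitney's embedding theorem: multiples of secants of the image of the
sphere depend on `2 (d - 1) + 1` parameters, values of the differentials along the sphere on
`(d - 1) + d` parameters, so that neither family fills a space of dimension `n > 2 d - 1`. -/
theorem exists_notMem_secants_notMem_tangents (hd : 1 ≤ d) (hn : 2 * d - 1 < n)
    {f : EuclideanSpace ℝ (Fin d) → EuclideanSpace ℝ (Fin n)} (hf : ContDiff ℝ 2 f) :
    ∃ v : EuclideanSpace ℝ (Fin n), (∀ (x y : S d) (t : ℝ), t • (f x - f y) ≠ v) ∧
      ∀ (x : S d) (w : EuclideanSpace ℝ (Fin d)), fderiv ℝ f x w ≠ v := by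
  obtain ⟨u, K, φ, hK, hφ, hcov⟩ := exists_contDiff_parametrization hd
  have hf1 : ContDiff ℝ 1 f := hf.of_le one_le_two
  have hf' : ContDiff ℝ 1 (fderiv ℝ f) := hf.fderiv_right (by norm_num [one_add_one_eq_two])
  let h₁ : K × K × ℝ → EuclideanSpace ℝ (Fin n) := fun p => p.2.2 • (f (φ p.1) - f (φ p.2.1))
  let h₂ : K × ℝ → EuclideanSpace ℝ (Fin n) := fun p => p.2 • (f (φ p.1) - f u)
  let h₃ : K × EuclideanSpace ℝ (Fin d) → EuclideanSpace ℝ (Fin n) :=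
    fun p => fderiv ℝ f (φ p.1) p.2
  let h₄ : EuclideanSpace ℝ (Fin d) → EuclideanSpace ℝ (Fin n) := fun w => fderiv ℝ f u w
  have hc₁ : ContDiff ℝ 1 h₁ := by fun_prop
  have hc₂ : ContDiff ℝ 1 h₂ := by fun_prop
  have hc₃ : ContDiff ℝ 1 h₃ :=
    (hf'.comp (hφ.comp contDiff_fst)).clm_apply contDiff_snd
  have hc₄ : ContDiff ℝ 1 h₄ := (fderiv ℝ f u).contDiff
  have hdim : dimH (Set.range h₁ ∪ Set.range h₂ ∪ (Set.range h₃ ∪ Set.range h₄)) <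
      Module.finrank ℝ (EuclideanSpace ℝ (Fin n)) := by
    rw [dimH_union, dimH_union, dimH_union, finrank_euclideanSpace_fin]
    refine max_lt (max_lt ?_ ?_) (max_lt ?_ ?_)
    · refine hc₁.dimH_range_le.trans_lt (Nat.cast_lt.2 ?_)
      simp only [Module.finrank_prod, hK, Module.finrank_self]
      omega
    · refine hc₂.dimH_range_le.trans_lt (Nat.cast_lt.2 ?_)
      simp only [Module.finrank_prod, hK, Module.finrank_self]
      omega
    · refine hc₃.dimH_range_le.trans_lt (Nat.cast_lt.2 ?_)
      simp only [Module.finrank_prod, hK, finrank_euclideanSpace_fin]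
      omega
    · refine hc₄.dimH_range_le.trans_lt (Nat.cast_lt.2 ?_)
      simp only [finrank_euclideanSpace_fin]
      omega
  obtain ⟨v, hv⟩ := (dense_compl_of_dimH_lt_finrank hdim).nonempty
  simp only [Set.mem_compl_iff, Set.mem_union, Set.mem_range, not_or, not_exists] at hv
  obtain ⟨⟨hv₁, hv₂⟩, hv₃, hv₄⟩ := hv
  refine ⟨v, fun x y t => ?_, fun x w => ?_⟩
  · rcases hcov x with hx | ⟨a, ha⟩ <;> rcases hcov y with hy | ⟨b, hb⟩
    · simpa [h₂, hx, hy] using hv₂ (0, 0)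
    · have := hv₂ (b, -t)
      simp only [h₂, hb] at this
      rwa [neg_smul, ← smul_neg, neg_sub, ← hx] at this
    · simpa [h₂, ha, hy] using hv₂ (a, t)
    · simpa [h₁, ha, hb] using hv₁ (a, b, t)
  · rcases hcov x with hx | ⟨a, ha⟩
    · simpa [h₄, hx] using hv₄ w
    · simpa [h₃, ha] using hv₃ (a, w)

variable [Finite G]

/-- Projecting along a direction that is neither a secant nor a tangent preserves the lower bound,
because it keeps orbits separated and differentials injective. -/
theorem IsInvariant.exists_hasLowerBoundOn_of_succ (hd : 1 ≤ d) (hn : 2 * d - 1 ≤ n)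
    {P : Fin (n + 1) → MvPolynomial (Fin d) ℝ} (hP : IsInvariant G P)
    (h : HasLowerBoundOn G P Set.univ) :
    ∃ Q : Fin n → MvPolynomial (Fin d) ℝ, IsInvariant G Q ∧ HasLowerBoundOn G Q Set.univ := by
  obtain ⟨v, hsec, htan⟩ := exists_notMem_secants_notMem_tangents hd (Nat.lt_succ_of_le hn)
    (contDiff_polyMap P)
  have hv : v ≠ 0 := fun h0 => htan ⟨EuclideanSpace.single ⟨0, hd⟩ 1, by simp⟩ 0 (by simp [h0])
  obtain ⟨L, hL⟩ := exists_continuousLinearMap_ker_le_span hv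
  -- A nonzero element of the kernel of `L` has `v` among its multiples.
  have hL' : ∀ z, L z = 0 → z = 0 ∨ ∃ t : ℝ, t • z = v := by
    intro z hz
    obtain ⟨s, rfl⟩ := hL z hz
    by_cases hs : s = 0
    · simp [hs]
    · exact Or.inr ⟨s⁻¹, by rw [smul_smul, inv_mul_cancel₀ hs, one_smul]⟩
  refine ⟨_, hP.linComp L, (hP.linComp L).hasLowerBoundOn_univ (fun x y hxy => ?_)
    fun x w hxw hw => ?_⟩
  · rw [polyMap_linComp, polyMap_linComp, ← sub_eq_zero, ← map_sub] at hxy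
    rcases hL' _ hxy with h0 | ⟨t, ht⟩
    · obtain ⟨α, hα, h⟩ := h
      have h1 := h (x, y) trivial
      rw [sub_eq_zero.1 h0, dist_self] at h1
      exact dist_le_zero.1 (nonpos_of_mul_nonpos_right h1 hα)
    · exact absurd ht (hsec x y t)
  · rw [fderiv_polyMap_linComp] at hw
    rcases hL' _ hw with h0 | ⟨t, ht⟩
    · exact h.fderiv_ne_zero x hxw h0
    · rw [← map_smul] at ht
      exact absurd ht (htan x _)

end Projection

/-! ### Concatenation of polynomial maps -/

section Append

variable {d n m : ℕ} {G : Subgroup (O d)}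

theorem dist_polyMap_append_sq (P : Fin n → MvPolynomial (Fin d) ℝ)
    (Q : Fin m → MvPolynomial (Fin d) ℝ) (x y : EuclideanSpace ℝ (Fin d)) :
    dist (polyMap (Fin.append P Q) x) (polyMap (Fin.append P Q) y) ^ 2 =
      dist (polyMap P x) (polyMap P y) ^ 2 + dist (polyMap Q x) (polyMap Q y) ^ 2 := by
  simp [EuclideanSpace.dist_sq_eq, Fin.sum_univ_add, polyMap]

theorem IsInvariant.append {P : Fin n → MvPolynomial (Fin d) ℝ}
    {Q : Fin m → MvPolynomial (Fin d) ℝ} (hP : IsInvariant G P) (hQ : IsInvariant G Q) :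
    IsInvariant G (Fin.append P Q) := fun g x => by
  rw [← dist_eq_zero, ← sq_eq_zero_iff, dist_polyMap_append_sq, hP g x, hQ g x]
  simp

variable [Finite G]

theorem HasLowerBoundOn.append_left {P : Fin n → MvPolynomial (Fin d) ℝ} {s : Set (S d × S d)}
    (h : HasLowerBoundOn G P s) (Q : Fin m → MvPolynomial (Fin d) ℝ) :
    HasLowerBoundOn G (Fin.append P Q) s := by
  obtain ⟨α, hα, h⟩ := h
  refine ⟨α, hα, fun p hp => (h p hp).trans (abs_le_of_sq_le_sq' ?_ dist_nonneg).2⟩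
  rw [dist_polyMap_append_sq]
  exact le_add_of_nonneg_right (sq_nonneg _)

theorem HasLowerBoundOn.append_right {Q : Fin m → MvPolynomial (Fin d) ℝ} {s : Set (S d × S d)}
    (h : HasLowerBoundOn G Q s) (P : Fin n → MvPolynomial (Fin d) ℝ) :
    HasLowerBoundOn G (Fin.append P Q) s := by
  obtain ⟨α, hα, h⟩ := h
  refine ⟨α, hα, fun p hp => (h p hp).trans (abs_le_of_sq_le_sq' ?_ dist_nonneg).2⟩
  rw [dist_polyMap_append_sq]
  exact le_add_of_nonneg_left (sq_nonneg _)

/-- Zero coordinates pad the target to dimension at least `2 d - 1`; projections then reduce it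
to `2 d - 1`. -/
theorem IsInvariant.exists_hasLowerBoundOn_two_mul_sub_one (hd : 1 ≤ d)
    {P : Fin n → MvPolynomial (Fin d) ℝ} (hP : IsInvariant G P)
    (h : HasLowerBoundOn G P Set.univ) :
    ∃ Q : Fin (2 * d - 1) → MvPolynomial (Fin d) ℝ,
      IsInvariant G Q ∧ HasLowerBoundOn G Q Set.univ := by
  have key : ∀ k, 2 * d - 1 ≤ k →
      (∃ Q : Fin k → MvPolynomial (Fin d) ℝ, IsInvariant G Q ∧ HasLowerBoundOn G Q Set.univ) →
      ∃ Q : Fin (2 * d - 1) → MvPolynomial (Fin d) ℝ,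
        IsInvariant G Q ∧ HasLowerBoundOn G Q Set.univ := by
    intro k hk
    induction k, hk using Nat.le_induction with
    | base => exact id
    | succ k hk ih =>
      rintro ⟨Q, hQ, hQ'⟩
      exact ih (hQ.exists_hasLowerBoundOn_of_succ hd hk hQ')
  refine key (n + (2 * d - 1)) (Nat.le_add_left _ _)
    ⟨Fin.append P fun _ => 0, hP.append fun g x => ?_, h.append_left _⟩
  simp [polyMap]

end Append

/-! ### Invariant polynomials of a free action -/

section Free

variable {d n : ℕ} {G : Subgroup (O d)}

/-- The polynomial `z ↦ ‖z - a‖ ^ 2`. -/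
def sqDistPoly (a : EuclideanSpace ℝ (Fin d)) : MvPolynomial (Fin d) ℝ :=
  ∑ j, (X j - C (a j)) ^ 2

theorem eval_sqDistPoly (a z : EuclideanSpace ℝ (Fin d)) :
    eval (fun j => z j) (sqDistPoly a) = ‖z - a‖ ^ 2 := by
  simp [sqDistPoly, EuclideanSpace.norm_sq_eq]

/-- The polynomial `z ↦ p (g z)`. -/
def precomp (g : O d) (p : MvPolynomial (Fin d) ℝ) : MvPolynomial (Fin d) ℝ :=
  bind₁ (fun j => ∑ k, C (g (EuclideanSpace.single k 1) j) * X k) p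

theorem eval_precomp (g : O d) (p : MvPolynomial (Fin d) ℝ) (z : EuclideanSpace ℝ (Fin d)) :
    eval (fun j => z j) (precomp g p) = eval (fun j => g z j) p := by
  have h : g z = ∑ k, z k • g (EuclideanSpace.single k 1) := by
    have h1 : z = ∑ k, z k • EuclideanSpace.single k (1 : ℝ) := by
      simpa using ((EuclideanSpace.basisFun (Fin d) ℝ).sum_repr z).symm
    conv_lhs => rw [h1]
    simp
  rw [precomp, eval, eval₂Hom_bind₁, h]
  congr 2
  funext j
  simp [mul_comm]

variable [Finite G]

/-- The product of the squared distances to the points of the orbit of `x` is invariant, and it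
vanishes on that orbit only. -/
theorem exists_isInvariant_polyMap_ne {x y : S d} (hxy : OrbitSpace.mk G x ≠ OrbitSpace.mk G y) :
    ∃ P : Fin 1 → MvPolynomial (Fin d) ℝ, IsInvariant G P ∧ polyMap P x ≠ polyMap P y := by
  cases nonempty_fintype G
  have heval : ∀ z : EuclideanSpace ℝ (Fin d), eval (fun j => z j)
      (∏ g : G, sqDistPoly ((g • x : S d) : EuclideanSpace ℝ (Fin d))) =
        ∏ g : G, ‖z - (g • x : S d)‖ ^ 2 := fun z => by
    simp [map_prod, eval_sqDistPoly]
  refine ⟨fun _ => ∏ g : G, sqDistPoly ((g • x : S d) : EuclideanSpace ℝ (Fin d)), ?_, ?_⟩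
  · intro h z
    ext i
    change eval (fun j => (h : O d) z j) _ = eval (fun j => z j) _
    rw [heval, heval]
    refine (Fintype.prod_equiv (Equiv.mulLeft h) _ _ fun g => ?_).symm
    rw [Equiv.coe_mulLeft, mul_smul, coe_smul G h, ← map_sub, LinearIsometryEquiv.norm_map]
  · intro he
    have h0 : eval (fun j => (x : EuclideanSpace ℝ (Fin d)) j) _ =
      eval (fun j => (y : EuclideanSpace ℝ (Fin d)) j) _ := congrArg (fun v => v 0) he
    rw [heval, heval, Finset.prod_eq_zero (Finset.mem_univ (1 : G)) (by simp)] at h0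
    obtain ⟨g, -, hg⟩ := Finset.prod_eq_zero_iff.1 h0.symm
    rw [sq_eq_zero_iff, norm_eq_zero, sub_eq_zero] at hg
    exact hxy (OrbitSpace.mk_eq_mk.2 ⟨g⁻¹, by rw [Subtype.ext hg, inv_smul_smul]⟩)

/-- Let `m` be the product of the squared distances to the points `g x ≠ x` of the orbit. The
invariant map `z ↦ ∑ h, m (h z) • (h z - x)` has differential `m x • id` at `x`, because `m`
vanishes to second order at the points `h x ≠ x`. -/
theorem ActsFreelyOnSphere.exists_isInvariant_fderiv_injective (hG : ActsFreelyOnSphere G)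
    (x : S d) : ∃ P : Fin d → MvPolynomial (Fin d) ℝ, IsInvariant G P ∧
      ∀ w, fderiv ℝ (polyMap P) x w = 0 → w = 0 := by
  classical
  cases nonempty_fintype G
  let M : MvPolynomial (Fin d) ℝ :=
    ∏ g ∈ (Finset.univ : Finset G).erase 1,
      sqDistPoly ((g • x : S d) : EuclideanSpace ℝ (Fin d))
  let m : EuclideanSpace ℝ (Fin d) → ℝ :=
    fun z => ∏ g ∈ (Finset.univ : Finset G).erase 1, ‖z - (g • x : S d)‖ ^ 2
  have hM : ∀ z : EuclideanSpace ℝ (Fin d), eval (fun j => z j) M = m z := fun z => by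
    simp [M, m, map_prod, eval_sqDistPoly]
  let P : Fin d → MvPolynomial (Fin d) ℝ := fun i =>
    ∑ h : G, precomp (h : O d) (M * (X i - C ((x : EuclideanSpace ℝ (Fin d)) i)))
  have hP : ∀ z, polyMap P z = ∑ h : G, m ((h : O d) z) • ((h : O d) z - x) := fun z => by
    ext i
    simp [P, polyMap, eval_precomp, hM]
  refine ⟨P, fun g z => ?_, fun w hw => ?_⟩
  · rw [hP, hP]
    exact Fintype.sum_equiv (Equiv.mulRight g) _ _ fun h => rfl
  have hm0 : m x ≠ 0 := by
    refine Finset.prod_ne_zero_iff.2 fun g hg => pow_ne_zero 2 ?_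
    rw [norm_ne_zero_iff, sub_ne_zero]
    exact fun h => Finset.ne_of_mem_erase hg (hG g x (Subtype.ext h.symm))
  have hmdiff : Differentiable ℝ m :=
    (contDiff_prod fun g _ => (contDiff_id.sub contDiff_const).norm_sq ℝ).differentiable one_ne_zero
  have hmz : ∀ h : G, h ≠ 1 → m ((h : O d) x) = 0 := fun h hh =>
    Finset.prod_eq_zero (Finset.mem_erase.2 ⟨hh, Finset.mem_univ h⟩) (by simp [coe_smul])
  have hmd : ∀ h : G, h ≠ 1 → HasFDerivAt m (0 : EuclideanSpace ℝ (Fin d) →L[ℝ] ℝ)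
      ((h : O d) x) := fun h hh => by
    have hmin : IsLocalMin m ((h : O d) x) := Eventually.of_forall fun z => by
      rw [hmz h hh]
      exact Finset.prod_nonneg fun g _ => sq_nonneg _
    rw [← hmin.fderiv_eq_zero]
    exact (hmdiff _).hasFDerivAt
  have hterm : ∀ h : G, HasFDerivAt (fun z => m ((h : O d) z) • ((h : O d) z - x))
      (if h = 1 then m x • ContinuousLinearMap.id ℝ (EuclideanSpace ℝ (Fin d)) else 0)
      (x : EuclideanSpace ℝ (Fin d)) := by
    intro h
    have hlin : HasFDerivAt (fun z => (h : O d) z)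
        ((h : O d).toContinuousLinearEquiv : EuclideanSpace ℝ (Fin d) →L[ℝ] _)
        (x : EuclideanSpace ℝ (Fin d)) := (h : O d).toContinuousLinearEquiv.hasFDerivAt
    by_cases hh : h = 1
    · subst hh
      have h1 := (hmdiff (x : EuclideanSpace ℝ (Fin d))).hasFDerivAt.smul
        ((hasFDerivAt_id (x : EuclideanSpace ℝ (Fin d))).sub_const
          (x : EuclideanSpace ℝ (Fin d)))
      rw [if_pos rfl]
      refine h1.congr_fderiv ?_
      ext w
      simp
    · have h1 := ((hmd h hh).comp (x : EuclideanSpace ℝ (Fin d)) hlin).smul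
        (hlin.sub_const (x : EuclideanSpace ℝ (Fin d)))
      rw [if_neg hh]
      refine h1.congr_fderiv ?_
      ext w
      simp [hmz h hh]
  have hsum : HasFDerivAt (polyMap P) (m x • ContinuousLinearMap.id ℝ (EuclideanSpace ℝ (Fin d)))
      (x : EuclideanSpace ℝ (Fin d)) := by
    have h1 := HasFDerivAt.fun_sum (u := Finset.univ) fun h _ => hterm h
    rw [Finset.sum_ite_eq' Finset.univ (1 : G), if_pos (Finset.mem_univ _)] at h1
    rwa [funext hP]
  rw [hsum.fderiv] at hw
  exact (smul_eq_zero.1 hw).resolve_left hm0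

/-- By compactness, finitely many of the locally adapted invariant maps combine to one with a global
lower bound. -/
theorem ActsFreelyOnSphere.exists_hasLowerBoundOn (hG : ActsFreelyOnSphere G) :
    ∃ (n : ℕ) (P : Fin n → MvPolynomial (Fin d) ℝ),
      IsInvariant G P ∧ HasLowerBoundOn G P Set.univ := by
  refine isCompact_univ.induction_on (p := fun s : Set (S d × S d) => ∃ (n : ℕ)
    (P : Fin n → MvPolynomial (Fin d) ℝ), IsInvariant G P ∧ HasLowerBoundOn G P s) ?_ ?_ ?_ ?_
  · exact ⟨0, Fin.elim0, fun _ _ => Subsingleton.elim _ _, 1, one_pos, by simp⟩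
  · rintro s t hst ⟨n, P, hP, h⟩
    exact ⟨n, P, hP, h.mono hst⟩
  · rintro s t ⟨n, P, hP, hs⟩ ⟨k, Q, hQ, ht⟩
    exact ⟨n + k, Fin.append P Q, hP.append hQ, (hs.append_left Q).union (ht.append_right P)⟩
  · rintro ⟨x, y⟩ -
    rw [nhdsWithin_univ]
    by_cases hxy : OrbitSpace.mk G x = OrbitSpace.mk G y
    · obtain ⟨g, rfl⟩ := OrbitSpace.mk_eq_mk.1 hxy.symm
      obtain ⟨P, hP, hinj⟩ := hG.exists_isInvariant_fderiv_injective x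
      obtain ⟨s, hs, h⟩ := hP.exists_hasLowerBoundOn (x := x) (fun w _ => hinj w) g
      exact ⟨s, hs, d, P, hP, h⟩
    · obtain ⟨P, hP, hne⟩ := exists_isInvariant_polyMap_ne hxy
      obtain ⟨s, hs, h⟩ := exists_hasLowerBoundOn_of_ne (G := G) hne
      exact ⟨s, hs, 1, P, hP, h⟩

end Free

end OrbitMetric

end

theorem mainTheorem3 (d : ℕ) (hd : 1 ≤ d) (G : Subgroup (OrbitMetric.O d)) [Finite G] :
    List.TFAE [
      OrbitMetric.ActsFreelyOnSphere G,
      ∃ (n : ℕ) (F : OrbitMetric.OrbitSpace G (OrbitMetric.S d) → EuclideanSpace ℝ (Fin n)),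
        OrbitMetric.IsPolynomialMap G F ∧ OrbitMetric.IsBilipschitz F,
      ∃ F : OrbitMetric.OrbitSpace G (OrbitMetric.S d) → EuclideanSpace ℝ (Fin (2 * d - 1)),
        OrbitMetric.IsPolynomialMap G F ∧ OrbitMetric.IsBilipschitz F] := by
  simp only [OrbitMetric.exists_isBilipschitz_iff]
  tfae_have 1 → 2 := fun h => h.exists_hasLowerBoundOn
  tfae_have 2 → 3 := fun ⟨_, _, hP, h⟩ => hP.exists_hasLowerBoundOn_two_mul_sub_one hd h
  tfae_have 3 → 1 := fun ⟨_, hP, h⟩ => h.actsFreelyOnSphere hP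
  tfae_finish
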